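/- Let $X$ be an integral projective scheme over a field $k$ (for instance a projective K3 surface with at worst rational double points over $\mathbb{C}$), that is, $X$ is integral and proper over $k$ and carries an ample line bundle $L$, which we fix. For a coherent sheaf $\mathscr{F}$ on $X$ let $\operatorname{rk}\mathscr{F}$ be the dimension of its generic stalk over the function field of $X$, let $\chi(\mathscr{F})=\sum_i(-1)^i\dim_k H^i(X,\mathscr{F})$, and let $P_{\mathscr{F}}$ be the Hilbert polynomial with respect to $L$, i.e. the polynomial with $P_{\mathscr{F}}(n)=\chi(\mathscr{F}\otimes L^{\otimes n})$. A non-zero torsion-free coherent sheaf $\mathscr{E}$ on $X$ is called (Gieseker) semistable, respectively stable, if for every coherent subsheaf $\mathscr{F}\subset\mathscr{E}$ with $0<\operatorname{rk}\mathscr{F}<\operatorname{rk}\mathscr{E}$ one has $$\frac{P_{\mathscr{F}}(n)}{\operatorname{rk}\mathscr{F}}\le\frac{P_{\mathscr{E}}(n)}{\operatorname{rk}\mathscr{E}},\qquad\text{respectively}\qquad \frac{P_{\mathscr{F}}(n)}{\operatorname{rk}\mathscr{F}}<\frac{P_{\mathscr{E}}(n)}{\operatorname{rk}\mathscr{E}},\qquad\text{for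 all sufficiently large } n.$$ If $\mathscr{E}$ is semistable and the integers $\operatorname{rk}\mathscr{E}$ and $\chi(\mathscr{E})$ are coprime, then $\mathscr{E}$ is stable. -/

import Mathlib

universe u

open CategoryTheory AlgebraicGeometry TopologicalSpace

namespace GiesekerStability

noncomputable section

variable {X : Scheme.{u}}

/-- The structure sheaf `𝒪_X`, as a module over itself. -/
def structureSheaf (X : Scheme.{u}) : X.Modules := SheafOfModules.unit X.ringCatSheaf

/-- Coherent sheaves on a (locally Noetherian) scheme: quasi-coherent of finite type. -/
def IsCoherent (M : X.Modules) : Prop :=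
  SheafOfModules.IsQuasicoherent (R := X.ringCatSheaf) M ∧
    SheafOfModules.IsFiniteType (R := X.ringCatSheaf) M

/-- `M ⊗ N` over `𝒪_X`: the sheaf associated with `U ↦ M(U) ⊗ N(U)`. -/
def tensor (M N : X.Modules) : X.Modules :=
  (PresheafOfModules.sheafification (𝟙 X.ringCatSheaf.obj)).obj
    (PresheafOfModules.Monoidal.tensorObj (R := X.presheaf) M.val N.val)

/-- The twist `M ⊗ L ⊗ ⋯ ⊗ L` with `n` factors `L`. -/
def twist (L M : X.Modules) : ℕ → X.Modules
  | 0 => M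
  | n + 1 => tensor (twist L M n) L

/-- Invertible sheaves: locally isomorphic to `𝒪_X`. -/
def IsInvertible (L : X.Modules) : Prop :=
  ∀ x : X, ∃ U : X.Opens, x ∈ U ∧
    Nonempty (L.restrict U.ι ≅ structureSheaf (U : Scheme.{u}))

/-- `M` is generated by its global sections. -/
def IsGloballyGenerated (M : X.Modules) : Prop :=
  Nonempty (SheafOfModules.GeneratingSections (R := X.ringCatSheaf) M)

/-- Ampleness of an invertible sheaf (on a Noetherian scheme): every coherent sheaf becomes
globally generated after all sufficiently high twists. -/
def IsAmple (L : X.Modules) : Prop :=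
  IsInvertible L ∧
    ∀ M : X.Modules, IsCoherent M → ∃ n₀ : ℕ, ∀ n ≥ n₀, IsGloballyGenerated (twist L M n)

/-- The stalk of `M` at `x`, a module over `𝒪_{X,x}`. -/
abbrev stalk (M : X.Modules) (x : X) : Type u := ↑(TopCat.Presheaf.stalk (C := Ab) M.presheaf x)

instance (M : X.Modules) (x : X) : Module (X.presheaf.stalk x) (stalk M x) :=
  let N : PresheafOfModules.{u} (X.presheaf ⋙ forget₂ CommRingCat RingCat) := M.val
  (inferInstance : Module (X.presheaf.stalk x) ↑(TopCat.Presheaf.stalk (C := Ab) N.presheaf x))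

/-- Torsion-free sheaves on an integral scheme. -/
def IsTorsionFree (M : X.Modules) : Prop :=
  ∀ (x : X) (r : X.presheaf.stalk x) (m : stalk M x), r • m = 0 → r = 0 ∨ m = 0

/-- The rank of a coherent sheaf on an integral scheme: the dimension, over the function field,
of its stalk at the generic point. -/
def rank [IsIntegral X] (M : X.Modules) : ℕ :=
  Module.finrank X.functionField (stalk M (genericPoint X))

/-- The abelian sheaf underlying `M`. -/
def abSheaf (M : X.Modules) : Sheaf (Opens.grothendieckTopology X) Ab.{u} :=
  ⟨M.presheaf, M.isSheaf⟩

/-- Multiplication by a global function, as an endomorphism of the abelian sheaf `M`. -/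
def scalarHom (M : X.Modules) (a : Γ(X, ⊤)) : abSheaf M ⟶ abSheaf M where
  hom :=
    { app := fun U => M.smul (X.presheaf.map (homOfLE (le_top : U.unop ≤ ⊤)).op a)
      naturality := by
        intro U V i
        have h := Scheme.Modules.map_comp_smul (M := M) i.unop
          (X.presheaf.map (homOfLE (le_top : U.unop ≤ ⊤)).op a)
        rw [← ConcreteCategory.comp_apply, ← X.presheaf.map_comp] at h
        exact h.symm }

lemma scalarHom_one (M : X.Modules) : scalarHom M 1 = 𝟙 _ := by
  refine Sheaf.hom_ext (NatTrans.ext (funext fun U => ?_))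
  change M.smul (X.presheaf.map (homOfLE (le_top : U.unop ≤ ⊤)).op 1) = 𝟙 _
  rw [map_one, map_one]
  rfl

lemma scalarHom_zero (M : X.Modules) : scalarHom M 0 = 0 := by
  refine Sheaf.hom_ext (NatTrans.ext (funext fun U => ?_))
  change M.smul (X.presheaf.map (homOfLE (le_top : U.unop ≤ ⊤)).op 0) = 0
  rw [map_zero, map_zero]

lemma scalarHom_add (M : X.Modules) (a b : Γ(X, ⊤)) :
    scalarHom M (a + b) = scalarHom M a + scalarHom M b := by
  refine Sheaf.hom_ext (NatTrans.ext (funext fun U => ?_))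
  change M.smul (X.presheaf.map (homOfLE (le_top : U.unop ≤ ⊤)).op (a + b)) =
    M.smul (X.presheaf.map (homOfLE (le_top : U.unop ≤ ⊤)).op a) +
      M.smul (X.presheaf.map (homOfLE (le_top : U.unop ≤ ⊤)).op b)
  rw [map_add, map_add]

lemma scalarHom_mul (M : X.Modules) (a b : Γ(X, ⊤)) :
    scalarHom M (a * b) = scalarHom M b ≫ scalarHom M a := by
  refine Sheaf.hom_ext (NatTrans.ext (funext fun U => ?_))
  change M.smul (X.presheaf.map (homOfLE (le_top : U.unop ≤ ⊤)).op (a * b)) =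
    M.smul (X.presheaf.map (homOfLE (le_top : U.unop ≤ ⊤)).op b) ≫
      M.smul (X.presheaf.map (homOfLE (le_top : U.unop ≤ ⊤)).op a)
  rw [map_mul, map_mul]
  rfl

/-- The cohomology group `H^n(X, M)`. -/
def Cohomology (M : X.Modules) (n : ℕ) : Type u := (abSheaf M).H n

instance (M : X.Modules) (n : ℕ) : AddCommGroup (Cohomology M n) :=
  inferInstanceAs (AddCommGroup ((abSheaf M).H n))

/-- The action of global functions on cohomology, by functoriality. -/
def cohomologyAction (M : X.Modules) (n : ℕ) : Γ(X, ⊤) →+* AddMonoid.End (Cohomology M n) where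
  toFun a := Sheaf.H.map (scalarHom M a) n
  map_one' := by
    ext x
    change Sheaf.H.map (scalarHom M 1) n x = x
    rw [scalarHom_one, Sheaf.H.map_id_apply]
  map_mul' a b := by
    ext x
    change Sheaf.H.map (scalarHom M (a * b)) n x = _
    rw [scalarHom_mul, Sheaf.H.map_comp_apply]
    rfl
  map_zero' := by
    ext x
    change Sheaf.H.map (scalarHom M 0) n x = 0
    rw [scalarHom_zero, Sheaf.H.map_apply, Abelian.Ext.mk₀_zero, Abelian.Ext.comp_zero]
  map_add' a b := by
    ext x
    change Sheaf.H.map (scalarHom M (a + b)) n x = _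
    rw [scalarHom_add, Sheaf.H.map_add_apply]
    rfl

variable {k : Type u} [Field k]

/-- The action of `k` on the cohomology of a sheaf on a `k`-scheme. -/
def baseAction (f : X ⟶ Spec (CommRingCat.of k)) (M : X.Modules) (n : ℕ) :
    k →+* AddMonoid.End (Cohomology M n) :=
  (cohomologyAction M n).comp
    ((Scheme.ΓSpecIso (CommRingCat.of k)).inv ≫ f.appTop).hom

/-- `dim_k H^n(X, M)`. -/
def h (f : X ⟶ Spec (CommRingCat.of k)) (M : X.Modules) (n : ℕ) : ℕ :=
  letI : Module k (Cohomology M n) := Module.compHom (Cohomology M n) (baseAction f M n)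
  Module.finrank k (Cohomology M n)

/-- The Euler characteristic `χ(M) = ∑ (-1)^n dim_k H^n(X, M)`. -/
def eulerChar (f : X ⟶ Spec (CommRingCat.of k)) (M : X.Modules) : ℤ :=
  ∑ᶠ n : ℕ, (-1) ^ n * (h f M n : ℤ)

/-- `P` is the Hilbert polynomial of `M` with respect to `L`, i.e. `P(n) = χ(M ⊗ L^n)`. As a
polynomial is determined by its values at the natural numbers, there is at most one such `P`. -/
def IsHilbertPolynomial (f : X ⟶ Spec (CommRingCat.of k)) (L M : X.Modules)
    (P : Polynomial ℚ) : Prop :=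
  ∀ n : ℕ, P.eval (n : ℚ) = (eulerChar f (twist L M n) : ℚ)

/-- Gieseker semistability with respect to `L`: `E` is a non-zero torsion-free coherent sheaf and
`P_F(n) / rk F ≤ P_E(n) / rk E` for `n ≫ 0`, for all coherent subsheaves `F` with
`0 < rk F < rk E`, where `P_F` and `P_E` are the Hilbert polynomials. -/
structure IsSemistable [IsIntegral X] (f : X ⟶ Spec (CommRingCat.of k)) (L E : X.Modules) :
    Prop where
  coherent : IsCoherent E
  torsionFree : IsTorsionFree E
  nonzero : ¬ Limits.IsZero E
  le : ∀ (F : X.Modules) (i : F ⟶ E), Mono i → IsCoherent F → 0 < rank F → rank F < rank E →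
    ∀ P Q : Polynomial ℚ, IsHilbertPolynomial f L F P → IsHilbertPolynomial f L E Q →
      ∀ᶠ n : ℕ in Filter.atTop, P.eval (n : ℚ) / rank F ≤ Q.eval (n : ℚ) / rank E

/-- Gieseker stability with respect to `L`: as semistability, with strict inequalities. -/
structure IsStable [IsIntegral X] (f : X ⟶ Spec (CommRingCat.of k)) (L E : X.Modules) :
    Prop where
  coherent : IsCoherent E
  torsionFree : IsTorsionFree E
  nonzero : ¬ Limits.IsZero E
  lt : ∀ (F : X.Modules) (i : F ⟶ E), Mono i → IsCoherent F → 0 < rank F → rank F < rank E →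
    ∀ P Q : Polynomial ℚ, IsHilbertPolynomial f L F P → IsHilbertPolynomial f L E Q →
      ∀ᶠ n : ℕ in Filter.atTop, P.eval (n : ℚ) / rank F < Q.eval (n : ℚ) / rank E

end

end GiesekerStability

/-! Write `p_F = P_F / rk F` for the reduced Hilbert polynomial. Two rational polynomials agreeing
at infinitely many integers coincide, so the semistability inequality for `F ⊂ E` is either strict
for all large `n` or an identity `p_F = p_E`. An identity may be evaluated at `n = 0`, far from the
asymptotic range, where it reads `χ(F) / rk F = χ(E) / rk E`. Since `χ(F)` is an integer, `rk E`
divides `χ(E) * rk F`, hence `rk F` by coprimality, which is impossible for `0 < rk F < rk E`. -/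

open Filter in
/-- Two rational polynomials with `p ≤ q` at all large natural numbers are either equal or satisfy
`p < q` at all large natural numbers. -/
theorem Polynomial.eq_or_eventually_eval_natCast_lt {p q : Polynomial ℚ}
    (hle : ∀ᶠ n : ℕ in atTop, p.eval (n : ℚ) ≤ q.eval (n : ℚ)) :
    p = q ∨ ∀ᶠ n : ℕ in atTop, p.eval (n : ℚ) < q.eval (n : ℚ) := by
  refine or_iff_not_imp_right.2 fun hlt => Polynomial.eq_of_infinite_eval_eq p q ?_
  -- If strictness is not eventual, `q ≤ p` holds for arbitrarily large `n`; together with the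
  -- eventual `p ≤ q` this gives equality infinitely often.
  have heq : ∃ᶠ n : ℕ in atTop, p.eval (n : ℚ) = q.eval (n : ℚ) :=
    ((not_eventually.1 hlt).and_eventually hle).mono fun n hn => hn.2.antisymm (not_lt.1 hn.1)
  exact ((Nat.frequently_atTop_iff_infinite.1 heq).image Nat.cast_injective.injOn).mono
    (Set.image_subset_iff.2 fun _ hn => hn)

/-- The Hilbert polynomial at `0` is the Euler characteristic. -/
theorem GiesekerStability.IsHilbertPolynomial.eval_zero {k : Type u} [Field k] {X : Scheme.{u}}
    {f : X ⟶ Spec (CommRingCat.of k)} {L M : X.Modules} {P : Polynomial ℚ}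
    (hP : GiesekerStability.IsHilbertPolynomial f L M P) :
    P.eval 0 = (GiesekerStability.eulerChar f M : ℚ) := by
  -- The zeroth twist is `M` itself by definition, so no isomorphism `M ⊗ 𝒪_X ≅ M` is needed.
  simpa [GiesekerStability.twist] using hP 0

/-- If `a / s = b / r` with `r` coprime to `b` and `0 < s`, then `r ≤ s`. -/
theorem Nat.le_of_div_eq_div_of_isCoprime {r s : ℕ} {a b : ℤ} (hr : 0 < r) (hs : 0 < s)
    (hcop : IsCoprime (r : ℤ) b) (h : (a : ℚ) / s = (b : ℚ) / r) : r ≤ s := by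
  rw [div_eq_div_iff (by positivity) (by positivity)] at h
  have hdvd : (r : ℤ) ∣ b * s := ⟨a, by rw [mul_comm (r : ℤ)]; exact_mod_cast h.symm⟩
  exact Nat.le_of_dvd hs (Int.natCast_dvd_natCast.1 (hcop.dvd_of_dvd_mul_left hdvd))

/-- A Gieseker semistable sheaf on a polarised integral projective scheme over a field, whose rank
and Euler characteristic are coprime, is Gieseker stable. -/
theorem proposition3p7 {k : Type u} [Field k] {X : Scheme.{u}} [IsIntegral X]
    (f : X ⟶ Spec (CommRingCat.of k)) [IsProper f]
    (L : X.Modules) (hL : GiesekerStability.IsAmple L)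
    (E : X.Modules) (hE : GiesekerStability.IsSemistable f L E)
    (hcop : IsCoprime (GiesekerStability.rank E : ℤ) (GiesekerStability.eulerChar f E)) :
    GiesekerStability.IsStable f L E := by
  refine ⟨hE.coherent, hE.torsionFree, hE.nonzero, fun F i hi hF h0 hlt P Q hP hQ => ?_⟩
  -- The quotients by the ranks are rewritten as values of genuine polynomials, so that the
  -- dichotomy applies to them.
  have eval_smul (R : Polynomial ℚ) (r : ℕ) (x : ℚ) :
      (Polynomial.C (r : ℚ)⁻¹ * R).eval x = R.eval x / r := by
    rw [Polynomial.eval_C_mul, inv_mul_eq_div]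
  have hle := hE.le F i hi hF h0 hlt P Q hP hQ
  simp only [← eval_smul] at hle ⊢
  refine (Polynomial.eq_or_eventually_eval_natCast_lt hle).resolve_left fun heq => ?_
  have h := congrArg (Polynomial.eval 0) heq
  rw [eval_smul, eval_smul, hP.eval_zero, hQ.eval_zero] at h
  exact hlt.not_ge (Nat.le_of_div_eq_div_of_isCoprime (h0.trans hlt) h0 hcop h)
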